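/- Let $m,r,d_1,\dots,d_m\ge 1$ be integers, $D=\sum_{i=1}^m d_i$, and write $\mathcal O_{d,r}=\{O\in\mathbb R^{d\times r}: O^TO=I_r\}$. For $X\in\mathbb R^{D\times D}$ let $X_{ij}\in\mathbb R^{d_i\times d_j}$ be its $(i,j)$ block, and for $Y\in\mathbb R^{D\times r}$ let $[Y]_i\in\mathbb R^{d_i\times r}$ be its $i$-th block of rows; $\|\cdot\|$ is the operator norm and $\|\cdot\|_F$ the Frobenius norm. Assume the MAXBET model: $\Theta_i\in\mathcal O_{d_i,r}$ for all $i$, $W\in\mathbb R^{D\times D}$ satisfies $W_{ij}=W_{ji}^T$ for all $i,j$, and $S_{ij}=\Theta_i\Theta_j^T+W_{ij}$ for all $1\le i,j\le m$, i.e. $S=\Theta\Theta^T+W$, where $\Theta\in\mathbb R^{D\times r}$ is obtained by stacking $\Theta_1,\dots,\Theta_m$. Consider the problems (OTSM) maximize $\sum_{1\le i,j\le m}\operatorname{tr}(O_i^TS_{ij}O_j)$ over $O_i\in\mathcal O_{d_i,r}$, $i=1,\dots,m$; (rank-$r$) maximize $\operatorname{tr}(SU)$ over $U=U^T\in\mathbb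 R^{D\times D}$ with $U\succcurlyeq 0$, $\operatorname{rank}(U)=r$, and $U_{ii}\preccurlyeq I$, $\operatorname{tr}(U_{ii})=r$ for $i=1,\dots,m$; (SDP) the rank-$r$ problem without the constraint $\operatorname{rank}(U)=r$. **Theorem 3.1.** Put $A=\max_{1\le i\le m}\|[W\Theta]_i\|_F+4\|W\|^2\sqrt{r/m}$. Suppose that $m>\|W\|(4\sqrt r+1)+1$ and $$m> 4m\,\frac{2A}{m-\|W\|(4\sqrt r+1)-1}+2A+8\|W\|\sqrt{\frac rm}+2\|W\|.$$ Then the relaxation is tight: (SDP) has a solution, and every solution $\hat U$ of (SDP) also solves the rank-$r$ problem and has the form $\hat U=OO^T$, where $O\in\mathbb R^{D\times r}$ is obtained by stacking some solution $(O_1,\dots,O_m)$ of (OTSM). -/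

import Mathlib

namespace OTSM

open scoped Matrix

/-- Row indices of a matrix with `D = d₁ + ⋯ + d_m` rows, split into `m` blocks;
`⟨i, a⟩` is the `a`-th row of the `i`-th block. -/
abbrev Idx {m : ℕ} (d : Fin m → ℕ) : Type := Σ i : Fin m, Fin (d i)

/-- The `(i, j)` block `X_{ij}` (of size `d_i × d_j`) of a `D × D` matrix. -/
def block {m : ℕ} {d : Fin m → ℕ} (X : Matrix (Idx d) (Idx d) ℝ) (i j : Fin m) :
    Matrix (Fin (d i)) (Fin (d j)) ℝ :=
  Matrix.of fun a b => X ⟨i, a⟩ ⟨j, b⟩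

/-- The `i`-th block `Y_i` (of size `d_i × r`) of a `D × r` matrix. -/
def rowBlock {m r : ℕ} {d : Fin m → ℕ} (Y : Matrix (Idx d) (Fin r) ℝ) (i : Fin m) :
    Matrix (Fin (d i)) (Fin r) ℝ :=
  Matrix.of fun a k => Y ⟨i, a⟩ k

/-- The `D × r` matrix obtained by stacking `O₁, …, O_m` vertically. -/
def stack {m r : ℕ} {d : Fin m → ℕ} (O : (i : Fin m) → Matrix (Fin (d i)) (Fin r) ℝ) :
    Matrix (Idx d) (Fin r) ℝ :=
  Matrix.of fun p k => O p.1 p.2 k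

/-- The Stiefel manifold `𝒪_{d,r}` of semi-orthogonal `d × r` matrices. -/
def stiefel (d r : ℕ) : Set (Matrix (Fin d) (Fin r) ℝ) :=
  {O | Oᵀ * O = 1}

/-- The operator norm of a square real matrix, as a map between Euclidean spaces. -/
noncomputable def opNorm {n : Type*} [Fintype n] [DecidableEq n] (X : Matrix n n ℝ) : ℝ :=
  ‖Matrix.toEuclideanCLM (𝕜 := ℝ) X‖

/-- The Frobenius norm of a real matrix. -/
noncomputable def frobNorm {p q : Type*} [Fintype p] [Fintype q] (X : Matrix p q ℝ) : ℝ :=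
  √(∑ a, ∑ b, X a b ^ 2)

/-- The MAXBET model: `S_{ij} = Θ_i Θ_jᵀ + W_{ij}` with `Θ_i` semi-orthogonal and
`W_{ij} = W_{ji}ᵀ`, for all `i, j` (the diagonal blocks included). -/
structure IsMAXBET {m r : ℕ} {d : Fin m → ℕ}
    (Θ : (i : Fin m) → Matrix (Fin (d i)) (Fin r) ℝ) (W S : Matrix (Idx d) (Idx d) ℝ) :
    Prop where
  semiorth : ∀ i, Θ i ∈ stiefel (d i) r
  noise_symm : ∀ i j, block W i j = (block W j i)ᵀ
  model : ∀ i j, block S i j = Θ i * (Θ j)ᵀ + block W i j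

/-- `O = (O₁, …, O_m)` is a (global) solution of the orthogonal trace-sum maximization problem. -/
def IsOTSMSolution {m r : ℕ} {d : Fin m → ℕ} (S : Matrix (Idx d) (Idx d) ℝ)
    (O : (i : Fin m) → Matrix (Fin (d i)) (Fin r) ℝ) : Prop :=
  (∀ i, O i ∈ stiefel (d i) r) ∧
    IsMaxOn (fun Q : (i : Fin m) → Matrix (Fin (d i)) (Fin r) ℝ =>
        ∑ i, ∑ j, ((Q i)ᵀ * block S i j * Q j).trace)
      {Q | ∀ i, Q i ∈ stiefel (d i) r} O

/-- The constraint set of the semidefinite relaxation: `U = Uᵀ`, `U ≽ 0`, and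
`U_{ii} ≼ I`, `tr U_{ii} = r` for every `i`. -/
def sdpFeasible {m : ℕ} (d : Fin m → ℕ) (r : ℕ) : Set (Matrix (Idx d) (Idx d) ℝ) :=
  {U | U.IsSymm ∧ U.PosSemidef ∧
    ∀ i, (1 - block U i i).PosSemidef ∧ (block U i i).trace = r}

/-- The constraint set of the rank-`r` problem: that of the relaxation and `rank U = r`. -/
def rankFeasible {m : ℕ} (d : Fin m → ℕ) (r : ℕ) : Set (Matrix (Idx d) (Idx d) ℝ) :=
  {U | U ∈ sdpFeasible d r ∧ U.rank = r}

/-- `U` solves the semidefinite relaxation: it maximizes `tr(S U)`, which is `⟨S, U⟩` as `U` is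
symmetric, over the constraint set of the relaxation. -/
def IsSDPSolution {m : ℕ} {d : Fin m → ℕ} (r : ℕ) (S U : Matrix (Idx d) (Idx d) ℝ) : Prop :=
  U ∈ sdpFeasible d r ∧
    IsMaxOn (fun U' : Matrix (Idx d) (Idx d) ℝ => (S * U').trace) (sdpFeasible d r) U

/-- `U` solves the rank-`r` problem: it maximizes `tr(S U)` over the rank-`r` constraint set. -/
def IsRankSolution {m : ℕ} {d : Fin m → ℕ} (r : ℕ) (S U : Matrix (Idx d) (Idx d) ℝ) : Prop :=
  U ∈ rankFeasible d r ∧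
    IsMaxOn (fun U' : Matrix (Idx d) (Idx d) ℝ => (S * U').trace) (rankFeasible d r) U

/-- `max_i ‖[W Θ]_i‖_F + 4 ‖W‖² √(r/m)`. -/
noncomputable def noiseLevel {m r : ℕ} {d : Fin m → ℕ}
    (Θ : (i : Fin m) → Matrix (Fin (d i)) (Fin r) ℝ) (W : Matrix (Idx d) (Idx d) ℝ) : ℝ :=
  (⨆ i : Fin m, frobNorm (rowBlock (W * stack Θ) i)) +
    4 * opNorm W ^ 2 * √((r : ℝ) / (m : ℝ))

end OTSM

/-!
Some solution `O` of the trace-sum problem is aligned with the signal, in the sense that `Θᵀ O` is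
positive semidefinite. Comparing the objective at `O` and at `Θ` bounds `‖O - Θ‖`; replacing a
single block `O_i` by `Θ_i` then bounds every `‖O_i - Θ_i‖`. Hence each Lagrange multiplier
`Λ_i = O_iᵀ [S O]_i` is close to `Θᵀ O`, so bounded below by nearly `m`, whereas `S` is small on the
orthogonal complement of the range of `O`. The slack matrix of the dual problem built from the `Λ_i`
annihilates `O` and is positive definite on that complement, and complementary slackness leaves
`O Oᵀ` as the only solution of the relaxation.
-/

namespace OTSM

open scoped Matrix Matrix.Norms.Frobenius InnerProductSpace

theorem frobNorm_eq_norm {p q : Type*} [Fintype p] [Fintype q] (A : Matrix p q ℝ) :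
    frobNorm A = ‖A‖ := by
  rw [frobNorm, Matrix.frobenius_norm_def, Real.sqrt_eq_rpow]
  simp

/-- The Frobenius inner product `tr(Aᵀ B)` on real matrices, compatible with Mathlib's Frobenius
norm. -/
noncomputable local instance frobeniusInnerProductSpace {p q : Type*} [Fintype p] [Fintype q] :
    InnerProductSpace ℝ (Matrix p q ℝ) where
  inner A B := (Aᵀ * B).trace
  norm_sq_eq_re_inner A := by
    rw [← frobNorm_eq_norm, frobNorm, Real.sq_sqrt (by positivity), Finset.sum_comm]
    simp only [RCLike.re_to_real, Matrix.trace, Matrix.diag, Matrix.mul_apply,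
      Matrix.transpose_apply, sq]
  conj_inner_symm A B := by
    rw [← Matrix.trace_transpose]
    simp
  add_left A B C := by simp [Matrix.add_mul]
  smul_left A B c := by simp

section Frobenius

variable {p q n : Type*} [Fintype p] [Fintype q] [Fintype n]

theorem inner_eq_trace (A B : Matrix p q ℝ) : ⟪A, B⟫_ℝ = (Aᵀ * B).trace := rfl

theorem inner_transpose (A B : Matrix p q ℝ) : ⟪Aᵀ, Bᵀ⟫_ℝ = ⟪A, B⟫_ℝ := by
  rw [real_inner_comm, inner_eq_trace, inner_eq_trace, Matrix.transpose_transpose,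
    Matrix.trace_mul_comm]

theorem inner_mul_eq_inner_transpose_mul (A : Matrix p n ℝ) (B : Matrix n q ℝ)
    (C : Matrix p q ℝ) : ⟪A * B, C⟫_ℝ = ⟪B, Aᵀ * C⟫_ℝ := by
  simp only [inner_eq_trace, Matrix.transpose_mul, Matrix.mul_assoc]

theorem inner_mul_eq_inner_mul_transpose (A : Matrix p n ℝ) (B : Matrix n q ℝ)
    (C : Matrix p q ℝ) : ⟪A * B, C⟫_ℝ = ⟪A, C * Bᵀ⟫_ℝ := by
  simp only [inner_eq_trace, Matrix.transpose_mul, Matrix.mul_assoc]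
  rw [Matrix.trace_mul_comm, Matrix.mul_assoc]

theorem norm_one_eq_sqrt_card [DecidableEq n] :
    ‖(1 : Matrix n n ℝ)‖ = √(Fintype.card n) := by
  simpa using congrArg NNReal.toReal (Matrix.frobenius_nnnorm_one (n := n) (α := ℝ))

theorem opNorm_nonneg [DecidableEq p] (W : Matrix p p ℝ) : 0 ≤ opNorm W := norm_nonneg _

theorem norm_mul_le_opNorm [DecidableEq p] (W : Matrix p p ℝ) (X : Matrix p q ℝ) :
    ‖W * X‖ ≤ opNorm W * ‖X‖ := by
  have norm_sq_eq_sum_col (Y : Matrix p q ℝ) : ‖Y‖ ^ 2 = ∑ b, ‖WithLp.toLp 2 (Y.col b)‖ ^ 2 := by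
    simp only [← frobNorm_eq_norm, frobNorm, EuclideanSpace.norm_sq_eq]
    rw [Real.sq_sqrt (by positivity), Finset.sum_comm]
    simp
  refine abs_le_of_sq_le_sq' ?_ (mul_nonneg (opNorm_nonneg W) (norm_nonneg X)) |>.2
  rw [mul_pow, norm_sq_eq_sum_col, norm_sq_eq_sum_col, Finset.mul_sum]
  refine Finset.sum_le_sum fun b _ => ?_
  rw [← mul_pow]
  exact pow_le_pow_left₀ (norm_nonneg _)
    ((Matrix.toEuclideanCLM (𝕜 := ℝ) W).le_opNorm (WithLp.toLp 2 (X.col b))) 2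

theorem abs_inner_mul_self_le [DecidableEq p] (W : Matrix p p ℝ) (X : Matrix p q ℝ) :
    |⟪X, W * X⟫_ℝ| ≤ opNorm W * ‖X‖ ^ 2 :=
  calc |⟪X, W * X⟫_ℝ| ≤ ‖X‖ * ‖W * X‖ := abs_real_inner_le_norm _ _
    _ ≤ ‖X‖ * (opNorm W * ‖X‖) := by gcongr; exact norm_mul_le_opNorm W X
    _ = opNorm W * ‖X‖ ^ 2 := by ring

theorem norm_mul_of_gram [DecidableEq n] {A : Matrix p n ℝ} {c : ℝ} (hA : Aᵀ * A = c • 1)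
    (X : Matrix n q ℝ) : ‖A * X‖ = √c * ‖X‖ := by
  have h : ‖A * X‖ ^ 2 = c * ‖X‖ ^ 2 := by
    rw [← real_inner_self_eq_norm_sq, inner_mul_eq_inner_transpose_mul, ← Matrix.mul_assoc, hA,
      Matrix.smul_mul, Matrix.one_mul, real_inner_smul_right, real_inner_self_eq_norm_sq]
  rw [← Real.sqrt_sq (norm_nonneg (A * X)), h, Real.sqrt_mul' _ (sq_nonneg _),
    Real.sqrt_sq (norm_nonneg X)]

theorem norm_of_gram [DecidableEq n] {A : Matrix p n ℝ} {c : ℝ} (hA : Aᵀ * A = c • 1) :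
    ‖A‖ = √c * √(Fintype.card n) := by
  have h := norm_mul_of_gram hA (1 : Matrix n n ℝ)
  rwa [Matrix.mul_one, norm_one_eq_sqrt_card] at h

theorem mul_le_of_mul_sq_le {c x b : ℝ} (hx : 0 ≤ x) (hb : 0 ≤ b) (h : c * x ^ 2 ≤ b * x) :
    c * x ≤ b := by
  rcases hx.eq_or_lt with rfl | hx
  · simpa using hb
  · exact le_of_mul_le_mul_right (by rwa [mul_assoc, ← sq]) hx

theorem norm_transpose_mul_of_gram [DecidableEq n] {A : Matrix p n ℝ} {c : ℝ}
    (hA : Aᵀ * A = c • 1) (Y : Matrix p q ℝ) : ‖Aᵀ * Y‖ ≤ √c * ‖Y‖ := by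
  rw [← one_mul ‖Aᵀ * Y‖]
  refine mul_le_of_mul_sq_le (norm_nonneg _) (by positivity) ?_
  calc 1 * ‖Aᵀ * Y‖ ^ 2 = ⟪A * (Aᵀ * Y), Y⟫_ℝ := by
        rw [inner_mul_eq_inner_transpose_mul, real_inner_self_eq_norm_sq, one_mul]
    _ ≤ ‖A * (Aᵀ * Y)‖ * ‖Y‖ := real_inner_le_norm _ _
    _ = √c * ‖Y‖ * ‖Aᵀ * Y‖ := by rw [norm_mul_of_gram hA]; ring

theorem inner_add_mul_add {S : Matrix p p ℝ} (hS : S.IsSymm) (V E : Matrix p q ℝ) :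
    ⟪V + E, S * (V + E)⟫_ℝ = ⟪V, S * V⟫_ℝ + 2 * ⟪E, S * V⟫_ℝ + ⟪E, S * E⟫_ℝ := by
  have h : ⟪V, S * E⟫_ℝ = ⟪E, S * V⟫_ℝ := by
    rw [real_inner_comm, inner_mul_eq_inner_transpose_mul, hS.eq]
  rw [Matrix.mul_add, inner_add_left, inner_add_right, inner_add_right, h]
  ring

end Frobenius

section Orthogonal

variable {n : Type*} [Fintype n] [DecidableEq n]

theorem exp_mem_orthogonalGroup {K : Matrix n n ℝ} (hK : Kᵀ = -K) :
    NormedSpace.exp K ∈ Matrix.orthogonalGroup n ℝ := by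
  rw [Matrix.mem_orthogonalGroup_iff, ← Matrix.exp_transpose, hK,
    Matrix.exp_neg, Matrix.mul_nonsing_inv]
  exact (Matrix.isUnit_exp K).map Matrix.detMonoidHom

theorem isSymm_of_inner_sub_one_le {N : Matrix n n ℝ} {c : ℝ}
    (h : ∀ Q ∈ Matrix.orthogonalGroup n ℝ, ⟪Q - 1, N⟫_ℝ ≤ c * ‖Q - 1‖ ^ 2) : N.IsSymm := by
  -- Along `t ↦ exp (t K)` the right-hand side vanishes to second order, so `⟪K, N⟫ = 0`.
  set K := N - Nᵀ with hK
  have hK_skew : Kᵀ = -K := by simp [hK]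
  set γ : ℝ → Matrix n n ℝ := fun t => NormedSpace.exp (t • K) - 1
  have hγ0 : γ 0 = 0 := by simp [γ]
  have hγ : HasDerivAt γ K 0 := by
    have h := hasDerivAt_exp_smul_const (𝕂 := ℝ) K 0
    rw [zero_smul, NormedSpace.exp_zero, one_mul] at h
    exact h.sub_const 1
  have hmax : IsLocalMax (fun t => ⟪γ t, N⟫_ℝ - c * ‖γ t‖ ^ 2) 0 :=
    .of_forall fun t => by
      have hskew : (t • K)ᵀ = -(t • K) := by rw [Matrix.transpose_smul, hK_skew, smul_neg]
      simpa [hγ0] using h _ (exp_mem_orthogonalGroup hskew)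
  have hKN : ⟪K, N⟫_ℝ = 0 := by
    simpa [hγ0] using hmax.hasDerivAt_eq_zero
      ((hγ.inner ℝ (hasDerivAt_const 0 N)).sub (hγ.norm_sq.const_mul c))
  have hKK : ⟪K, K⟫_ℝ = 0 := by
    have hKNt : ⟪K, Nᵀ⟫_ℝ = 0 := by
      rw [← inner_transpose, hK_skew, Matrix.transpose_transpose, inner_neg_left, hKN, neg_zero]
    rw [show ⟪K, K⟫_ℝ = ⟪K, N⟫_ℝ - ⟪K, Nᵀ⟫_ℝ from inner_sub_right _ _ _, hKN, hKNt, sub_zero]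
  exact (sub_eq_zero.mp (inner_self_eq_zero.mp hKK)).symm

theorem householder_mem_orthogonalGroup {x : n → ℝ} (hx : x ⬝ᵥ x ≠ 0) :
    1 - (2 / (x ⬝ᵥ x)) • Matrix.vecMulVec x x ∈ Matrix.orthogonalGroup n ℝ := by
  rw [Matrix.mem_orthogonalGroup_iff]
  have hscal : 2 / (x ⬝ᵥ x) * (2 / (x ⬝ᵥ x) * (x ⬝ᵥ x)) = 2 / (x ⬝ᵥ x) + 2 / (x ⬝ᵥ x) := by
    field_simp
    norm_num
  simp only [Matrix.transpose_sub, Matrix.transpose_one, Matrix.transpose_smul,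
    Matrix.transpose_vecMulVec, Matrix.sub_mul, Matrix.mul_sub, Matrix.one_mul, Matrix.mul_one,
    Matrix.smul_mul, Matrix.mul_smul, Matrix.vecMulVec_mul_vecMulVec, Matrix.vecMulVec_smul,
    smul_smul, smul_sub, hscal]
  module

theorem posSemidef_of_trace_mul_le {P : Matrix n n ℝ}
    (h : ∀ Q ∈ Matrix.orthogonalGroup n ℝ, (P * Q).trace ≤ P.trace) : P.PosSemidef := by
  have hsymm : Pᵀ.IsSymm := isSymm_of_inner_sub_one_le (c := 0) fun Q hQ => by
    rw [zero_mul, inner_eq_trace, ← Matrix.transpose_mul, Matrix.trace_transpose, Matrix.mul_sub,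
      Matrix.mul_one, Matrix.trace_sub]
    exact sub_nonpos.mpr (h Q hQ)
  refine Matrix.PosSemidef.of_dotProduct_mulVec_nonneg hsymm.eq.symm fun x => ?_
  rw [star_trivial]
  rcases eq_or_ne x 0 with rfl | hx
  · simp
  have hpos : 0 < x ⬝ᵥ x := by simpa using Matrix.dotProduct_star_self_pos_iff.mpr hx
  have hreflect := h _ (householder_mem_orthogonalGroup hpos.ne')
  rw [Matrix.mul_sub, Matrix.mul_one, Matrix.trace_sub, Matrix.mul_smul, Matrix.trace_smul,
    Matrix.mul_vecMulVec, Matrix.trace_vecMulVec, smul_eq_mul] at hreflect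
  rw [dotProduct_comm]
  exact nonneg_of_mul_nonneg_right (a := 2 / (x ⬝ᵥ x)) (by linarith) (by positivity)

theorem isCompact_setOf_transpose_mul_self_eq_one (p n : Type*) [Fintype p] [Finite n]
    [DecidableEq n] : IsCompact {O : Matrix p n ℝ | Oᵀ * O = 1} := by
  have := Fintype.ofFinite n
  have : ProperSpace (Matrix p n ℝ) := FiniteDimensional.proper ℝ _
  refine Metric.isCompact_of_isClosed_isBounded
    (isClosed_eq (by fun_prop) continuous_const) ?_
  refine isBounded_iff_forall_norm_le.mpr ⟨√(Fintype.card n), fun O hO => ?_⟩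
  simpa using (norm_of_gram (c := 1) (by simpa using hO)).le

theorem exists_posSemidef_mul (M : Matrix n n ℝ) :
    ∃ Q ∈ Matrix.orthogonalGroup n ℝ, (M * Q).PosSemidef := by
  have hcompact : IsCompact (Matrix.orthogonalGroup n ℝ : Set (Matrix n n ℝ)) := by
    convert isCompact_setOf_transpose_mul_self_eq_one n n using 1
    ext Q
    exact Matrix.mem_orthogonalGroup_iff' n ℝ
  obtain ⟨Q, hQ, hmax⟩ := hcompact.exists_isMaxOn ⟨1, one_mem _⟩
    (f := fun Q => (M * Q).trace) (by fun_prop)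
  refine ⟨Q, hQ, posSemidef_of_trace_mul_le fun R hR => ?_⟩
  rw [Matrix.mul_assoc]
  exact hmax (mul_mem hQ hR)

end Orthogonal

section PosSemidef

variable {p q : Type*} [Fintype p] [Fintype q] {P : Matrix p p ℝ}

theorem inner_mul_nonneg_of_posSemidef (hP : P.PosSemidef) (X : Matrix p q ℝ) :
    0 ≤ ⟪X, P * X⟫_ℝ := by
  rw [inner_eq_trace, ← Matrix.mul_assoc]
  exact (hP.conjTranspose_mul_mul_same X).trace_nonneg

theorem posSemidef_of_inner_mul_self_nonneg (hP : P.IsSymm)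
    (h : ∀ X : Matrix p Unit ℝ, 0 ≤ ⟪X, P * X⟫_ℝ) : P.PosSemidef := by
  refine Matrix.PosSemidef.of_dotProduct_mulVec_nonneg hP fun x => ?_
  simpa [inner_eq_trace, Matrix.trace, Matrix.mul_apply, Matrix.mulVec, dotProduct] using
    h (Matrix.replicateCol Unit x)

open scoped MatrixOrder in
theorem exists_eq_mul_transpose_self (hP : P.PosSemidef) : ∃ B : Matrix p p ℝ, P = B * Bᵀ := by
  classical
  obtain ⟨B, hB⟩ := CStarAlgebra.nonneg_iff_eq_mul_star_self.mp hP.nonneg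
  exact ⟨B, hB⟩

theorem trace_mul_nonneg {A : Matrix p p ℝ} (hA : A.PosSemidef) (hP : P.PosSemidef) :
    0 ≤ (A * P).trace := by
  obtain ⟨B, rfl⟩ := exists_eq_mul_transpose_self hP
  rw [← Matrix.mul_assoc, Matrix.trace_mul_comm, ← inner_eq_trace]
  exact inner_mul_nonneg_of_posSemidef hA B

end PosSemidef

section Blocks

variable {m r : ℕ} {d : Fin m → ℕ}

theorem rowBlock_mul_stack (S : Matrix (Idx d) (Idx d) ℝ)
    (O : (i : Fin m) → Matrix (Fin (d i)) (Fin r) ℝ) (i : Fin m) :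
    rowBlock (S * stack O) i = ∑ j, block S i j * O j := by
  ext a b
  simp only [rowBlock, Matrix.of_apply, Matrix.mul_apply, Matrix.sum_apply, Fintype.sum_sigma]
  rfl

theorem inner_eq_sum_rowBlock (X Y : Matrix (Idx d) (Fin r) ℝ) :
    ⟪X, Y⟫_ℝ = ∑ i, ⟪rowBlock X i, rowBlock Y i⟫_ℝ := by
  simp only [inner_eq_trace, Matrix.trace, Matrix.diag, Matrix.mul_apply, Fintype.sum_sigma]
  rw [Finset.sum_comm]
  rfl

theorem norm_sq_eq_sum_rowBlock (X : Matrix (Idx d) (Fin r) ℝ) :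
    ‖X‖ ^ 2 = ∑ i, ‖rowBlock X i‖ ^ 2 := by
  simp only [← real_inner_self_eq_norm_sq, inner_eq_sum_rowBlock X]

theorem norm_rowBlock_le (X : Matrix (Idx d) (Fin r) ℝ) (i : Fin m) : ‖rowBlock X i‖ ≤ ‖X‖ := by
  refine le_of_sq_le_sq ?_ (norm_nonneg _)
  rw [norm_sq_eq_sum_rowBlock X]
  exact Finset.single_le_sum (f := fun i => ‖rowBlock X i‖ ^ 2)
    (fun _ _ => sq_nonneg _) (Finset.mem_univ i)

theorem norm_le_sqrt_mul_of_rowBlock_le {X : Matrix (Idx d) (Fin r) ℝ} {ε : ℝ} (hε : 0 ≤ ε)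
    (h : ∀ i, ‖rowBlock X i‖ ≤ ε) : ‖X‖ ≤ √m * ε := by
  refine abs_le_of_sq_le_sq' ?_ (by positivity) |>.2
  rw [norm_sq_eq_sum_rowBlock, mul_pow, Real.sq_sqrt (Nat.cast_nonneg m)]
  calc ∑ i, ‖rowBlock X i‖ ^ 2 ≤ ∑ _i : Fin m, ε ^ 2 :=
        Finset.sum_le_sum fun i _ => pow_le_pow_left₀ (norm_nonneg _) (h i) 2
    _ = m * ε ^ 2 := by simp

theorem transpose_stack_mul_stack (X Y : (i : Fin m) → Matrix (Fin (d i)) (Fin r) ℝ) :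
    (stack X)ᵀ * stack Y = ∑ i, (X i)ᵀ * Y i := by
  ext a b
  simp only [Matrix.mul_apply, Matrix.sum_apply, Fintype.sum_sigma]
  rfl

theorem gram_stack {O : (i : Fin m) → Matrix (Fin (d i)) (Fin r) ℝ}
    (hO : ∀ i, O i ∈ stiefel (d i) r) : (stack O)ᵀ * stack O = (m : ℝ) • 1 := by
  rw [transpose_stack_mul_stack, Finset.sum_congr rfl fun i _ => hO i]
  simp [← Nat.cast_smul_eq_nsmul ℝ]

theorem sum_trace_eq_inner (S : Matrix (Idx d) (Idx d) ℝ)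
    (O : (i : Fin m) → Matrix (Fin (d i)) (Fin r) ℝ) :
    ∑ i, ∑ j, ((O i)ᵀ * block S i j * O j).trace = ⟪stack O, S * stack O⟫_ℝ := by
  rw [inner_eq_sum_rowBlock]
  refine Finset.sum_congr rfl fun i _ => ?_
  rw [rowBlock_mul_stack, inner_eq_trace, Matrix.mul_sum, Matrix.trace_sum]
  simp only [Matrix.mul_assoc]
  rfl

/-- The `D × r` matrix whose only nonzero row block is the `i`-th one, equal to `X`: the direction
in which a single `O_i` is varied. -/
def singleBlock (i : Fin m) (X : Matrix (Fin (d i)) (Fin r) ℝ) : Matrix (Idx d) (Fin r) ℝ :=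
  stack (Pi.single i X)

theorem rowBlock_singleBlock_self (i : Fin m) (X : Matrix (Fin (d i)) (Fin r) ℝ) :
    rowBlock (singleBlock i X) i = X := by
  ext a b
  simp [rowBlock, singleBlock, stack]

theorem rowBlock_singleBlock_of_ne {i j : Fin m} (hj : j ≠ i) (X : Matrix (Fin (d i)) (Fin r) ℝ) :
    rowBlock (singleBlock i X) j = 0 := by
  ext a b
  simp [rowBlock, singleBlock, stack, hj]

theorem inner_singleBlock (i : Fin m) (X : Matrix (Fin (d i)) (Fin r) ℝ)
    (Y : Matrix (Idx d) (Fin r) ℝ) : ⟪singleBlock i X, Y⟫_ℝ = ⟪X, rowBlock Y i⟫_ℝ := by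
  rw [inner_eq_sum_rowBlock, Finset.sum_eq_single i]
  · rw [rowBlock_singleBlock_self]
  · intro j _ hj
    rw [rowBlock_singleBlock_of_ne hj, inner_zero_left]
  · simp

theorem norm_singleBlock (i : Fin m) (X : Matrix (Fin (d i)) (Fin r) ℝ) :
    ‖singleBlock i X‖ = ‖X‖ := by
  rw [← sq_eq_sq₀ (norm_nonneg _) (norm_nonneg _), ← real_inner_self_eq_norm_sq, inner_singleBlock,
    rowBlock_singleBlock_self, real_inner_self_eq_norm_sq]

theorem stack_update (O : (i : Fin m) → Matrix (Fin (d i)) (Fin r) ℝ) (i : Fin m)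
    (X : Matrix (Fin (d i)) (Fin r) ℝ) :
    stack (Function.update O i X) = stack O + singleBlock i (X - O i) := by
  ext ⟨j, a⟩ b
  rcases eq_or_ne j i with rfl | h
  · simp [stack, singleBlock]
  · simp [stack, singleBlock, h]

end Blocks

section Optimality

variable {m r : ℕ} {d : Fin m → ℕ} {S : Matrix (Idx d) (Idx d) ℝ}
  {O : (i : Fin m) → Matrix (Fin (d i)) (Fin r) ℝ}

theorem isOTSMSolution_iff : IsOTSMSolution S O ↔ (∀ i, O i ∈ stiefel (d i) r) ∧
    ∀ Q : (i : Fin m) → Matrix (Fin (d i)) (Fin r) ℝ, (∀ i, Q i ∈ stiefel (d i) r) →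
      ⟪stack Q, S * stack Q⟫_ℝ ≤ ⟪stack O, S * stack O⟫_ℝ := by
  simp only [IsOTSMSolution, sum_trace_eq_inner]
  rfl

theorem exists_isOTSMSolution (S : Matrix (Idx d) (Idx d) ℝ) (hO : ∀ i, O i ∈ stiefel (d i) r) :
    ∃ Q : (i : Fin m) → Matrix (Fin (d i)) (Fin r) ℝ, IsOTSMSolution S Q := by
  have hcompact : IsCompact {Q : (i : Fin m) → Matrix (Fin (d i)) (Fin r) ℝ |
      ∀ i, Q i ∈ stiefel (d i) r} :=
    isCompact_pi_infinite fun i =>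
      isCompact_setOf_transpose_mul_self_eq_one (Fin (d i)) (Fin r)
  exact hcompact.exists_isMaxOn ⟨O, hO⟩ (by fun_prop)

theorem mul_mem_stiefel {e f : ℕ} {A : Matrix (Fin e) (Fin f) ℝ} {B : Matrix (Fin f) (Fin r) ℝ}
    (hA : A ∈ stiefel e f) (hB : B ∈ stiefel f r) : A * B ∈ stiefel e r := by
  change (A * B)ᵀ * (A * B) = 1
  rw [Matrix.transpose_mul, Matrix.mul_assoc, ← Matrix.mul_assoc Aᵀ,
    show Aᵀ * A = 1 from hA, Matrix.one_mul]
  exact hB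

theorem mem_stiefel_of_mem_orthogonalGroup {Q : Matrix (Fin r) (Fin r) ℝ}
    (hQ : Q ∈ Matrix.orthogonalGroup (Fin r) ℝ) : Q ∈ stiefel r r :=
  (Matrix.mem_orthogonalGroup_iff' _ _).mp hQ

theorem IsOTSMSolution.mul_orthogonal (hO : IsOTSMSolution S O) {Q : Matrix (Fin r) (Fin r) ℝ}
    (hQ : Q ∈ Matrix.orthogonalGroup (Fin r) ℝ) : IsOTSMSolution S fun i => O i * Q := by
  rw [isOTSMSolution_iff] at hO ⊢
  have hobjective : ⟪stack fun i => O i * Q, S * stack fun i => O i * Q⟫_ℝ =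
      ⟪stack O, S * stack O⟫_ℝ := by
    rw [show stack (fun i => O i * Q) = stack O * Q from rfl, inner_mul_eq_inner_mul_transpose,
      Matrix.mul_assoc, Matrix.mul_assoc, (Matrix.mem_orthogonalGroup_iff _ _).mp hQ,
      Matrix.mul_one]
  exact ⟨fun i => mul_mem_stiefel (hO.1 i) (mem_stiefel_of_mem_orthogonalGroup hQ),
    fun X hX => (hO.2 X hX).trans_eq hobjective.symm⟩

theorem IsOTSMSolution.update_le (hS : S.IsSymm) (hO : IsOTSMSolution S O) (i : Fin m)
    {X : Matrix (Fin (d i)) (Fin r) ℝ} (hX : X ∈ stiefel (d i) r) :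
    2 * ⟪X - O i, rowBlock (S * stack O) i⟫_ℝ +
      ⟪singleBlock i (X - O i), S * singleBlock i (X - O i)⟫_ℝ ≤ 0 := by
  rw [isOTSMSolution_iff] at hO
  have h := hO.2 (Function.update O i X) fun j => by
    rcases eq_or_ne j i with rfl | hj
    · simpa using hX
    · simpa [hj] using hO.1 j
  rw [stack_update, inner_add_mul_add hS, inner_singleBlock] at h
  linarith

/-- The Lagrange multiplier `Λ_i = O_iᵀ [S O]_i` of the constraint `O_iᵀ O_i = I`. -/
def multiplier (S : Matrix (Idx d) (Idx d) ℝ) (O : (i : Fin m) → Matrix (Fin (d i)) (Fin r) ℝ)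
    (i : Fin m) : Matrix (Fin r) (Fin r) ℝ :=
  (O i)ᵀ * rowBlock (S * stack O) i

/-- First-order critical points of the orthogonal trace-sum maximization problem:
`[S O]_i = O_i Λ_i` with symmetric multipliers `Λ_i`. -/
structure IsCriticalPoint (S : Matrix (Idx d) (Idx d) ℝ)
    (O : (i : Fin m) → Matrix (Fin (d i)) (Fin r) ℝ) : Prop where
  mem_stiefel : ∀ i, O i ∈ stiefel (d i) r
  isSymm_multiplier : ∀ i, (multiplier S O i).IsSymm
  mul_multiplier : ∀ i, O i * multiplier S O i = rowBlock (S * stack O) i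

theorem IsOTSMSolution.isSymm_rowBlock_mul_transpose (hS : S.IsSymm) (hO : IsOTSMSolution S O)
    (i : Fin m) : (rowBlock (S * stack O) i * (O i)ᵀ).IsSymm := by
  refine isSymm_of_inner_sub_one_le (c := opNorm S * ‖O i‖ ^ 2 / 2) fun Q hQ => ?_
  have hrotate := hO.update_le hS i
    (mul_mem_stiefel (mem_stiefel_of_mem_orthogonalGroup hQ) (hO.1 i))
  rw [show Q * O i - O i = (Q - 1) * O i by rw [Matrix.sub_mul, Matrix.one_mul]] at hrotate
  have hquad := neg_le_of_abs_le (abs_inner_mul_self_le S (singleBlock i ((Q - 1) * O i)))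
  rw [norm_singleBlock] at hquad
  have hnorm : opNorm S * ‖(Q - 1) * O i‖ ^ 2 ≤ opNorm S * (‖Q - 1‖ * ‖O i‖) ^ 2 := by
    gcongr
    · exact opNorm_nonneg S
    · exact Matrix.frobenius_norm_mul _ _
  rw [← inner_mul_eq_inner_mul_transpose]
  linarith

theorem IsOTSMSolution.isCriticalPoint (hS : S.IsSymm) (hO : IsOTSMSolution S O) :
    IsCriticalPoint S O := by
  have hgram (i : Fin m) : (O i)ᵀ * O i = 1 := hO.1 i
  have hsymm (i : Fin m) : O i * (rowBlock (S * stack O) i)ᵀ =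
      rowBlock (S * stack O) i * (O i)ᵀ := by
    simpa [Matrix.IsSymm] using hO.isSymm_rowBlock_mul_transpose hS i
  have hmul (i : Fin m) : O i * (multiplier S O i)ᵀ = rowBlock (S * stack O) i := by
    rw [multiplier, Matrix.transpose_mul, Matrix.transpose_transpose, ← Matrix.mul_assoc, hsymm,
      Matrix.mul_assoc, hgram, Matrix.mul_one]
  have hmultiplier (i : Fin m) : (multiplier S O i)ᵀ = multiplier S O i := by
    conv_rhs => rw [multiplier, ← hmul, ← Matrix.mul_assoc, hgram, Matrix.one_mul]
  exact ⟨hO.1, hmultiplier, fun i => by rw [← hmultiplier, hmul]⟩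

end Optimality

section Perturbation

variable {p q n : Type*} [Fintype p] [Fintype q] [Fintype n]

theorem inner_signal_add_noise_mul (T : Matrix p n ℝ) (W : Matrix p p ℝ) (Y : Matrix p q ℝ) :
    ⟪Y, (T * Tᵀ + W) * Y⟫_ℝ = ‖Tᵀ * Y‖ ^ 2 + ⟪Y, W * Y⟫_ℝ := by
  rw [Matrix.add_mul, inner_add_right, Matrix.mul_assoc, real_inner_comm,
    inner_mul_eq_inner_transpose_mul, real_inner_self_eq_norm_sq]

theorem inner_mul_self_sub_inner_mul_self {W : Matrix p p ℝ} (hW : W.IsSymm)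
    (V T : Matrix p q ℝ) :
    ⟪V, W * V⟫_ℝ - ⟪T, W * T⟫_ℝ = ⟪V - T, W * (V + T)⟫_ℝ := by
  have hcross : ⟪T, W * V⟫_ℝ = ⟪V, W * T⟫_ℝ := by
    rw [real_inner_comm, inner_mul_eq_inner_transpose_mul, hW.eq]
  rw [Matrix.mul_add, inner_sub_left, inner_add_right, inner_add_right, hcross]
  ring

theorem norm_sq_le_mul_trace [DecidableEq n] {P : Matrix n n ℝ} {c : ℝ} (hP : P.PosSemidef)
    (hc : ∀ X : Matrix n n ℝ, ‖P * X‖ ≤ c * ‖X‖) : ‖P‖ ^ 2 ≤ c * P.trace := by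
  obtain ⟨B, hB⟩ := exists_eq_mul_transpose_self hP
  have htrace : P.trace = ‖B‖ ^ 2 := by
    rw [hB, Matrix.trace_mul_comm, ← inner_eq_trace, real_inner_self_eq_norm_sq]
  calc ‖P‖ ^ 2 = ⟪B, P * B⟫_ℝ := by
        rw [real_inner_comm, inner_mul_eq_inner_mul_transpose, ← hB, real_inner_self_eq_norm_sq]
    _ ≤ ‖B‖ * ‖P * B‖ := real_inner_le_norm _ _
    _ ≤ ‖B‖ * (c * ‖B‖) := by gcongr; exact hc B
    _ = c * P.trace := by rw [htrace]; ring

variable [DecidableEq n] {m : ℝ} {T V : Matrix p n ℝ}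

theorem norm_gram_mul_le (hm : 0 ≤ m) (hT : Tᵀ * T = m • 1) (hV : Vᵀ * V = m • 1)
    (X : Matrix n q ℝ) : ‖Tᵀ * V * X‖ ≤ m * ‖X‖ :=
  calc ‖Tᵀ * V * X‖ ≤ √m * ‖V * X‖ := by
        rw [Matrix.mul_assoc]
        exact norm_transpose_mul_of_gram hT _
    _ = m * ‖X‖ := by rw [norm_mul_of_gram hV, ← mul_assoc, Real.mul_self_sqrt hm]

theorem le_inner_gram_mul (hm : 0 ≤ m) (hT : Tᵀ * T = m • 1) (X : Matrix n q ℝ) :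
    (m - √m * ‖V - T‖) * ‖X‖ ^ 2 ≤ ⟪X, Tᵀ * V * X⟫_ℝ := by
  have hsplit : ⟪X, Tᵀ * V * X⟫_ℝ = ‖T * X‖ ^ 2 + ⟪T * X, (V - T) * X⟫_ℝ := by
    rw [← real_inner_self_eq_norm_sq, ← inner_add_right, ← Matrix.add_mul, add_sub_cancel,
      inner_mul_eq_inner_transpose_mul, Matrix.mul_assoc]
  have hcross : -(‖T * X‖ * (‖V - T‖ * ‖X‖)) ≤ ⟪T * X, (V - T) * X⟫_ℝ :=
    neg_le_of_abs_le <| (abs_real_inner_le_norm _ _).trans <| by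
      gcongr
      exact Matrix.frobenius_norm_mul _ _
  rw [hsplit]
  rw [norm_mul_of_gram hT] at hcross ⊢
  rw [mul_pow, Real.sq_sqrt hm]
  linarith

theorem norm_sub_sq_of_gram (hm : 0 ≤ m) (hT : Tᵀ * T = m • 1) (hV : Vᵀ * V = m • 1) :
    ‖V - T‖ ^ 2 = 2 * (m * Fintype.card n - (Tᵀ * V).trace) := by
  rw [norm_sub_sq_real, real_inner_comm, inner_eq_trace, norm_of_gram hT, norm_of_gram hV,
    mul_pow, Real.sq_sqrt hm, Real.sq_sqrt (Nat.cast_nonneg _)]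
  ring

theorem norm_sub_le_of_objective_le [DecidableEq p] {W : Matrix p p ℝ} (hm : 0 < m)
    (hT : Tᵀ * T = m • 1) (hV : Vᵀ * V = m • 1) (hW : W.IsSymm) (hP : (Tᵀ * V).PosSemidef)
    (h : ⟪T, (T * Tᵀ + W) * T⟫_ℝ ≤ ⟪V, (T * Tᵀ + W) * V⟫_ℝ) :
    ‖V - T‖ ≤ 4 * opNorm W * √(Fintype.card n / m) := by
  rw [inner_signal_add_noise_mul, inner_signal_add_noise_mul] at h
  have hsignal : ‖Tᵀ * T‖ ^ 2 = m * (m * Fintype.card n) := by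
    rw [← one_mul (Tᵀ * T), hT, Matrix.mul_smul, Matrix.one_mul, norm_smul, norm_one_eq_sqrt_card,
      mul_pow, Real.sq_sqrt (Nat.cast_nonneg _), Real.norm_eq_abs, sq_abs]
    ring
  have haligned : ‖Tᵀ * V‖ ^ 2 ≤ m * (Tᵀ * V).trace :=
    norm_sq_le_mul_trace hP (norm_gram_mul_le hm.le hT hV)
  have hquad : m * ‖V - T‖ ^ 2 ≤ 4 * opNorm W * (√m * √(Fintype.card n)) * ‖V - T‖ :=
    calc m * ‖V - T‖ ^ 2 ≤ 2 * (‖Tᵀ * T‖ ^ 2 - ‖Tᵀ * V‖ ^ 2) := by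
          rw [norm_sub_sq_of_gram hm.le hT hV, hsignal]
          linarith
      _ ≤ 2 * ⟪V - T, W * (V + T)⟫_ℝ := by
          rw [← inner_mul_self_sub_inner_mul_self hW]
          linarith
      _ ≤ 2 * (‖V - T‖ * (opNorm W * (‖V‖ + ‖T‖))) := by
          refine mul_le_mul_of_nonneg_left ((real_inner_le_norm _ _).trans ?_) two_pos.le
          gcongr
          refine (norm_mul_le_opNorm W _).trans ?_
          gcongr
          · exact opNorm_nonneg W
          · exact norm_add_le V T
      _ = 4 * opNorm W * (√m * √(Fintype.card n)) * ‖V - T‖ := by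
          rw [norm_of_gram hT, norm_of_gram hV]
          ring
  have hbound := mul_le_of_mul_sq_le (norm_nonneg _)
    (by have := opNorm_nonneg W; positivity) hquad
  have hsqrt : m * √(Fintype.card n / m) = √m * √(Fintype.card n) := by
    rw [Real.sqrt_div' _ hm.le]
    field_simp
    rw [Real.sq_sqrt hm.le, mul_comm]
  refine le_of_mul_le_mul_left (hbound.trans_eq ?_) hm
  rw [← hsqrt]
  ring

end Perturbation

section BlockEstimates

variable {p q n : Type*} [Fintype p] [Fintype q] [Fintype n] [DecidableEq n]
  {O Θ : Matrix p n ℝ}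

theorem two_mul_inner_sub_mul (hO : Oᵀ * O = 1) (hΘ : Θᵀ * Θ = 1) {P : Matrix n n ℝ}
    (hP : P.IsSymm) : 2 * ⟪Θ - O, Θ * P⟫_ℝ = ⟪(Θ - O)ᵀ, P * (Θ - O)ᵀ⟫_ℝ := by
  have hleft : ⟪Θ - O, Θ * P⟫_ℝ = ⟪P, Θᵀ * (Θ - O)⟫_ℝ := by
    rw [real_inner_comm, inner_mul_eq_inner_transpose_mul]
  have hright : ⟪Θ - O, Θ * P⟫_ℝ = ⟪P, (Θ - O)ᵀ * Θ⟫_ℝ := by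
    rw [hleft, ← inner_transpose, hP.eq, Matrix.transpose_mul, Matrix.transpose_transpose]
  have hgram : Θᵀ * (Θ - O) + (Θ - O)ᵀ * Θ = (Θ - O)ᵀ * (Θ - O) := by
    simp only [Matrix.transpose_sub, Matrix.mul_sub, Matrix.sub_mul, hO, hΘ]
    abel
  calc 2 * ⟪Θ - O, Θ * P⟫_ℝ = ⟪P, (Θ - O)ᵀ * (Θ - O)⟫_ℝ := by
        rw [← hgram, inner_add_right, ← hleft, ← hright, two_mul]
    _ = ⟪(Θ - O)ᵀ, P * (Θ - O)ᵀ⟫_ℝ := by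
        rw [real_inner_comm (P * _), inner_mul_eq_inner_mul_transpose, Matrix.transpose_transpose]

theorem le_inner_transpose_mul_signal_add_noise (hO : Oᵀ * O = 1) (P : Matrix n n ℝ)
    (N : Matrix p n ℝ) (X : Matrix n q ℝ) :
    ⟪X, P * X⟫_ℝ - ‖Θ - O‖ * ‖P * X‖ * ‖X‖ - ‖N‖ * ‖X‖ ^ 2 ≤
      ⟪X, Oᵀ * (Θ * P + N) * X⟫_ℝ := by
  have hOX : ‖O * X‖ = ‖X‖ := by simpa using norm_mul_of_gram (c := 1) (by simpa using hO) X
  have hbound (Y : Matrix p n ℝ) (Z : Matrix n q ℝ) :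
      -(‖X‖ * (‖Y‖ * ‖Z‖)) ≤ ⟪O * X, Y * Z⟫_ℝ :=
    neg_le_of_abs_le <| (abs_real_inner_le_norm _ _).trans <| by
      rw [hOX]
      gcongr
      exact Matrix.frobenius_norm_mul _ _
  have hsplit : ⟪X, Oᵀ * (Θ * P + N) * X⟫_ℝ =
      ⟪X, P * X⟫_ℝ + ⟪O * X, (Θ - O) * (P * X)⟫_ℝ + ⟪O * X, N * X⟫_ℝ := by
    have hmain : ⟪X, P * X⟫_ℝ = ⟪O * X, O * (P * X)⟫_ℝ := by
      rw [inner_mul_eq_inner_transpose_mul, ← Matrix.mul_assoc, hO, Matrix.one_mul]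
    rw [hmain, ← inner_add_right, ← Matrix.add_mul, add_sub_cancel, ← inner_add_right,
      inner_mul_eq_inner_transpose_mul, ← Matrix.mul_assoc Θ, ← Matrix.add_mul, Matrix.mul_assoc]
  have hsignal := hbound (Θ - O) (P * X)
  have hnoise := hbound N X
  rw [hsplit]
  linarith

end BlockEstimates

section Coercive

variable {p q n : Type*} [Fintype p] [Fintype q] [Fintype n] [DecidableEq n]
  {L U : Matrix p p ℝ} {V : Matrix p n ℝ} {c κ : ℝ}

theorem mul_norm_sub_sq_le_inner (hc : c ≠ 0) (hV : Vᵀ * V = c • 1) (hL : L.IsSymm)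
    (hLV : L * V = 0)
    (hκ : ∀ R : Matrix p q ℝ, Vᵀ * R = 0 → κ * ‖R‖ ^ 2 ≤ ⟪R, L * R⟫_ℝ) (C : Matrix p q ℝ) :
    κ * ‖C - V * (c⁻¹ • (Vᵀ * C))‖ ^ 2 ≤ ⟪C, L * C⟫_ℝ := by
  set M := c⁻¹ • (Vᵀ * C)
  have horthogonal : Vᵀ * (C - V * M) = 0 := by
    rw [Matrix.mul_sub, ← Matrix.mul_assoc, hV, Matrix.smul_mul, Matrix.one_mul, smul_smul,
      mul_inv_cancel₀ hc, one_smul, sub_self]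
  have hLVM : L * (V * M) = 0 := by rw [← Matrix.mul_assoc, hLV, Matrix.zero_mul]
  have hexpand := inner_add_mul_add hL (V * M) (C - V * M)
  rw [add_sub_cancel, hLVM, inner_zero_right, inner_zero_right, mul_zero, add_zero,
    zero_add] at hexpand
  rw [hexpand]
  exact hκ _ horthogonal

theorem posSemidef_of_le_inner {n : Type*} [Finite n] [DecidableEq n] {V : Matrix p n ℝ}
    (hc : c ≠ 0) (hV : Vᵀ * V = c • 1) (hL : L.IsSymm) (hLV : L * V = 0) (hκ₀ : 0 ≤ κ)
    (hκ : ∀ R : Matrix p Unit ℝ, Vᵀ * R = 0 → κ * ‖R‖ ^ 2 ≤ ⟪R, L * R⟫_ℝ) : L.PosSemidef := by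
  have := Fintype.ofFinite n
  exact posSemidef_of_inner_mul_self_nonneg hL fun X =>
    le_trans (by positivity) (mul_norm_sub_sq_le_inner hc hV hL hLV hκ X)

theorem exists_eq_mul_mul_transpose_of_trace_nonpos (hc : c ≠ 0) (hV : Vᵀ * V = c • 1)
    (hL : L.IsSymm) (hLV : L * V = 0) (hκ₀ : 0 < κ)
    (hκ : ∀ R : Matrix p p ℝ, Vᵀ * R = 0 → κ * ‖R‖ ^ 2 ≤ ⟪R, L * R⟫_ℝ)
    (hU : U.PosSemidef) (htrace : (L * U).trace ≤ 0) :
    ∃ N : Matrix n n ℝ, U = V * N * Vᵀ := by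
  obtain ⟨C, rfl⟩ := exists_eq_mul_transpose_self hU
  set M := c⁻¹ • (Vᵀ * C)
  have hCLC : ⟪C, L * C⟫_ℝ ≤ 0 := by
    rwa [inner_eq_trace, Matrix.trace_mul_comm, Matrix.mul_assoc]
  have hCM : C - V * M = 0 := by
    have hzero := (mul_norm_sub_sq_le_inner hc hV hL hLV hκ C).trans hCLC
    exact norm_eq_zero.mp <| pow_eq_zero_iff two_ne_zero |>.mp <|
      le_antisymm (nonpos_of_mul_nonpos_right hzero hκ₀) (sq_nonneg _)
  refine ⟨M * Mᵀ, ?_⟩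
  rw [sub_eq_zero.mp hCM, Matrix.transpose_mul]
  simp only [Matrix.mul_assoc]

end Coercive

section Relaxation

variable {m r : ℕ} {d : Fin m → ℕ}

theorem trace_eq_sum_block (U : Matrix (Idx d) (Idx d) ℝ) :
    U.trace = ∑ i, (block U i i).trace := by
  simp only [Matrix.trace, Fintype.sum_sigma]
  rfl

theorem rowBlock_blockDiagonal'_mul (M : (i : Fin m) → Matrix (Fin (d i)) (Fin (d i)) ℝ)
    (Y : Matrix (Idx d) (Fin r) ℝ) (i : Fin m) :
    rowBlock (Matrix.blockDiagonal' M * Y) i = M i * rowBlock Y i := by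
  ext a b
  simp only [rowBlock, Matrix.of_apply, Matrix.mul_apply, Fintype.sum_sigma]
  rw [Finset.sum_eq_single i]
  · simp
  · intro j _ hj
    simp [Matrix.blockDiagonal'_apply_ne _ _ _ hj.symm]
  · simp

theorem trace_blockDiagonal'_mul (M : (i : Fin m) → Matrix (Fin (d i)) (Fin (d i)) ℝ)
    (U : Matrix (Idx d) (Idx d) ℝ) :
    (Matrix.blockDiagonal' M * U).trace = ∑ i, (M i * block U i i).trace := by
  simp only [Matrix.trace, Matrix.diag_apply, Matrix.mul_apply, Fintype.sum_sigma]
  refine Finset.sum_congr rfl fun i _ => Finset.sum_congr rfl fun a _ => ?_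
  rw [Finset.sum_eq_single i]
  · simp [block]
  · intro j _ hj
    simp [Matrix.blockDiagonal'_apply_ne _ _ _ hj.symm]
  · simp

theorem posSemidef_blockDiagonal' {M : (i : Fin m) → Matrix (Fin (d i)) (Fin (d i)) ℝ}
    (hM : ∀ i, (M i).PosSemidef) : (Matrix.blockDiagonal' M).PosSemidef := by
  choose B hB using fun i => exists_eq_mul_transpose_self (hM i)
  rw [funext hB, Matrix.blockDiagonal'_mul, ← Matrix.blockDiagonal'_transpose]
  exact Matrix.posSemidef_self_mul_conjTranspose _

variable {U : Matrix (Idx d) (Idx d) ℝ} {O : (i : Fin m) → Matrix (Fin (d i)) (Fin r) ℝ}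

theorem stack_mul_transpose_mem_sdpFeasible (hO : ∀ i, O i ∈ stiefel (d i) r) :
    stack O * (stack O)ᵀ ∈ sdpFeasible d r := by
  refine ⟨by simp [Matrix.IsSymm], Matrix.posSemidef_self_mul_conjTranspose _, fun i => ?_⟩
  have hgram : (O i)ᵀ * O i = 1 := hO i
  rw [show block (stack O * (stack O)ᵀ) i i = O i * (O i)ᵀ from rfl]
  constructor
  · have hidem : (1 - O i * (O i)ᵀ) * (1 - O i * (O i)ᵀ)ᵀ = 1 - O i * (O i)ᵀ := by
      have hproj : O i * (O i)ᵀ * (O i * (O i)ᵀ) = O i * (O i)ᵀ := by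
        rw [Matrix.mul_assoc, ← Matrix.mul_assoc (O i)ᵀ, hgram, Matrix.one_mul]
      simp [Matrix.sub_mul, Matrix.mul_sub, hproj]
    rw [← hidem]
    exact Matrix.posSemidef_self_mul_conjTranspose _
  · rw [Matrix.trace_mul_comm, hgram]
    simp

theorem rank_stack_mul_transpose (hm : m ≠ 0) (hO : ∀ i, O i ∈ stiefel (d i) r) :
    (stack O * (stack O)ᵀ).rank = r := by
  rw [Matrix.rank_self_mul_transpose, ← Matrix.rank_transpose_mul_self, gram_stack hO,
    Matrix.rank_of_isUnit, Fintype.card_fin]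
  simp [Matrix.isUnit_iff_isUnit_det, hm]

theorem posSemidef_one_sub_compress (hU : U ∈ sdpFeasible d r) (hO : ∀ i, O i ∈ stiefel (d i) r)
    (i : Fin m) : (1 - (O i)ᵀ * block U i i * O i).PosSemidef := by
  have hcompress := (hU.2.2 i).1.conjTranspose_mul_mul_same (O i)
  rwa [Matrix.conjTranspose_eq_transpose_of_trivial, Matrix.mul_sub, Matrix.mul_one,
    Matrix.sub_mul, show (O i)ᵀ * O i = 1 from hO i] at hcompress

theorem eq_stack_mul_transpose_of_eq_mul_mul (hm : m ≠ 0) (hU : U ∈ sdpFeasible d r)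
    (hO : ∀ i, O i ∈ stiefel (d i) r) {N : Matrix (Fin r) (Fin r) ℝ}
    (hN : U = stack O * N * (stack O)ᵀ) : U = stack O * (stack O)ᵀ := by
  obtain ⟨i⟩ : Nonempty (Fin m) := ⟨⟨0, Nat.pos_of_ne_zero hm⟩⟩
  have hgram : (O i)ᵀ * O i = 1 := hO i
  have hblock : block U i i = O i * N * (O i)ᵀ := by
    rw [hN]
    rfl
  have hcompress : (O i)ᵀ * block U i i * O i = N := by
    rw [hblock, Matrix.mul_assoc, Matrix.mul_assoc, hgram, Matrix.mul_one, ← Matrix.mul_assoc,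
      hgram, Matrix.one_mul]
  have htrace : N.trace = r := by
    rw [← (hU.2.2 i).2, hblock, Matrix.trace_mul_comm, ← Matrix.mul_assoc, hgram, Matrix.one_mul]
  have hpsd : (1 - N).PosSemidef := hcompress ▸ posSemidef_one_sub_compress hU hO i
  have hone : 1 - N = 0 := hpsd.trace_eq_zero_iff.mp (by simp [htrace])
  rw [hN, ← sub_eq_zero.mp hone, Matrix.mul_one]

theorem trace_of_mem_sdpFeasible (hU : U ∈ sdpFeasible d r) : U.trace = m * r := by
  rw [trace_eq_sum_block, Finset.sum_congr rfl fun i _ => (hU.2.2 i).2]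
  simp

theorem trace_blockDiagonal'_mul_le (hU : U ∈ sdpFeasible d r) (hO : ∀ i, O i ∈ stiefel (d i) r)
    {N : Fin m → Matrix (Fin r) (Fin r) ℝ} (hN : ∀ i, (N i).PosSemidef) :
    (Matrix.blockDiagonal' (fun i => O i * N i * (O i)ᵀ) * U).trace ≤ ∑ i, (N i).trace := by
  rw [trace_blockDiagonal'_mul]
  refine Finset.sum_le_sum fun i _ => ?_
  have hnonneg := trace_mul_nonneg (hN i) (posSemidef_one_sub_compress hU hO i)
  rw [Matrix.mul_sub, Matrix.mul_one, Matrix.trace_sub] at hnonneg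
  have hcycle : (O i * N i * (O i)ᵀ * block U i i).trace =
      (N i * ((O i)ᵀ * block U i i * O i)).trace := by
    rw [Matrix.mul_assoc, Matrix.mul_assoc, Matrix.trace_mul_comm]
    simp only [Matrix.mul_assoc]
  rw [hcycle]
  linarith

end Relaxation

section Certificate

variable {m r : ℕ} {d : Fin m → ℕ} {S U : Matrix (Idx d) (Idx d) ℝ}
  {O : (i : Fin m) → Matrix (Fin (d i)) (Fin r) ℝ} {z c : ℝ}

/-- The slack matrix `Z = z I + diag(O_i (Λ_i - z I) O_iᵀ) - S` of the dual of the semidefinite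
relaxation: a certificate that `O Oᵀ` solves the relaxation as soon as it is positive semidefinite
and each `Λ_i - z I` is. -/
noncomputable def dualSlack (S : Matrix (Idx d) (Idx d) ℝ)
    (O : (i : Fin m) → Matrix (Fin (d i)) (Fin r) ℝ) (z : ℝ) : Matrix (Idx d) (Idx d) ℝ :=
  z • 1 + Matrix.blockDiagonal' (fun i => O i * (multiplier S O i - z • 1) * (O i)ᵀ) - S

theorem IsCriticalPoint.isSymm_dualSlack (hS : S.IsSymm) (hO : IsCriticalPoint S O) :
    (dualSlack S O z).IsSymm := by
  have hmultiplier (i : Fin m) : (multiplier S O i)ᵀ = multiplier S O i := hO.isSymm_multiplier i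
  simp [Matrix.IsSymm, dualSlack, hS.eq, Matrix.blockDiagonal'_transpose, hmultiplier,
    Matrix.mul_assoc]

theorem IsCriticalPoint.dualSlack_mul_stack (hO : IsCriticalPoint S O) :
    dualSlack S O z * stack O = 0 := by
  have hblock (i : Fin m) : rowBlock (dualSlack S O z * stack O) i = 0 := by
    have hgram : (O i)ᵀ * O i = 1 := hO.mem_stiefel i
    have hdiag := rowBlock_blockDiagonal'_mul
      (fun i => O i * (multiplier S O i - z • 1) * (O i)ᵀ) (stack O) i
    rw [show rowBlock (stack O) i = O i from rfl, Matrix.mul_assoc, hgram, Matrix.mul_one,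
      Matrix.mul_sub, hO.mul_multiplier, Matrix.mul_smul, Matrix.mul_one] at hdiag
    rw [dualSlack, Matrix.sub_mul, Matrix.add_mul, Matrix.smul_mul, Matrix.one_mul]
    change z • O i + rowBlock (Matrix.blockDiagonal'
      (fun i => O i * (multiplier S O i - z • 1) * (O i)ᵀ) * stack O) i -
        rowBlock (S * stack O) i = 0
    rw [hdiag]
    abel
  ext ⟨i, a⟩ b
  exact congrFun (congrFun (hblock i) a) b

theorem le_inner_dualSlack_mul {q : Type*} [Fintype q]
    (hz : ∀ i, (multiplier S O i - z • 1).PosSemidef) (R : Matrix (Idx d) q ℝ) :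
    z * ‖R‖ ^ 2 - ⟪R, S * R⟫_ℝ ≤ ⟪R, dualSlack S O z * R⟫_ℝ := by
  have hdiag := inner_mul_nonneg_of_posSemidef
    (posSemidef_blockDiagonal' fun i => (hz i).mul_mul_conjTranspose_same (O i)) R
  simp only [Matrix.conjTranspose_eq_transpose_of_trivial] at hdiag
  rw [dualSlack, Matrix.sub_mul, Matrix.add_mul, Matrix.smul_mul, Matrix.one_mul, inner_sub_right,
    inner_add_right, real_inner_smul_right, real_inner_self_eq_norm_sq]
  linarith

theorem trace_dualSlack_mul_le (hO : ∀ i, O i ∈ stiefel (d i) r)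
    (hz : ∀ i, (multiplier S O i - z • 1).PosSemidef) (hU : U ∈ sdpFeasible d r) :
    (dualSlack S O z * U).trace ≤ (S * (stack O * (stack O)ᵀ)).trace - (S * U).trace := by
  have hdiag := trace_blockDiagonal'_mul_le hU hO hz
  simp only [Matrix.trace_sub, Matrix.trace_smul, Matrix.trace_one, Finset.sum_sub_distrib,
    Finset.sum_const, Finset.card_univ, Fintype.card_fin, nsmul_eq_mul, smul_eq_mul] at hdiag
  have hobjective : (S * (stack O * (stack O)ᵀ)).trace = ∑ i, (multiplier S O i).trace := by
    rw [← Matrix.mul_assoc, Matrix.trace_mul_comm]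
    exact inner_eq_sum_rowBlock _ _
  rw [dualSlack, Matrix.sub_mul, Matrix.add_mul, Matrix.smul_mul, Matrix.one_mul,
    Matrix.trace_sub, Matrix.trace_add, Matrix.trace_smul, trace_of_mem_sdpFeasible hU,
    smul_eq_mul, hobjective]
  linarith

theorem IsCriticalPoint.isSDPSolution_iff (hm : m ≠ 0) (hS : S.IsSymm) (hO : IsCriticalPoint S O)
    (hcz : c < z) (hz : ∀ i, (multiplier S O i - z • 1).PosSemidef)
    (hc : ∀ (q : Type) [Fintype q] (R : Matrix (Idx d) q ℝ), (stack O)ᵀ * R = 0 →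
      ⟪R, S * R⟫_ℝ ≤ c * ‖R‖ ^ 2) :
    IsSDPSolution r S U ↔ U = stack O * (stack O)ᵀ := by
  have hfeasible := stack_mul_transpose_mem_sdpFeasible hO.mem_stiefel
  have hm' : (m : ℝ) ≠ 0 := Nat.cast_ne_zero.mpr hm
  have hgram := gram_stack hO.mem_stiefel
  have hsymm := hO.isSymm_dualSlack hS (z := z)
  have hcoercive (q : Type) [Fintype q] (R : Matrix (Idx d) q ℝ) (hR : (stack O)ᵀ * R = 0) :
      (z - c) * ‖R‖ ^ 2 ≤ ⟪R, dualSlack S O z * R⟫_ℝ := by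
    linarith [le_inner_dualSlack_mul hz R, hc q R hR]
  have hpsd : (dualSlack S O z).PosSemidef :=
    posSemidef_of_le_inner hm' hgram hsymm hO.dualSlack_mul_stack (sub_nonneg.mpr hcz.le)
      (hcoercive Unit)
  constructor
  · intro hU
    have hslack : (dualSlack S O z * U).trace ≤ 0 :=
      (trace_dualSlack_mul_le hO.mem_stiefel hz hU.1).trans (sub_nonpos.mpr (hU.2 hfeasible))
    obtain ⟨N, hN⟩ := exists_eq_mul_mul_transpose_of_trace_nonpos hm' hgram hsymm
      hO.dualSlack_mul_stack (sub_pos.mpr hcz) (hcoercive (Idx d)) hU.1.2.1 hslack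
    exact eq_stack_mul_transpose_of_eq_mul_mul hm hU.1 hO.mem_stiefel hN
  · rintro rfl
    refine ⟨hfeasible, fun X hX => ?_⟩
    have hgap := (trace_mul_nonneg hpsd hX.2.1).trans (trace_dualSlack_mul_le hO.mem_stiefel hz hX)
    exact sub_nonneg.mp hgap

end Certificate

section Tightness

variable {m r : ℕ} {d : Fin m → ℕ} {Θ O : (i : Fin m) → Matrix (Fin (d i)) (Fin r) ℝ}
  {W S : Matrix (Idx d) (Idx d) ℝ}

theorem IsMAXBET.isSymm_noise (h : IsMAXBET Θ W S) : W.IsSymm := by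
  ext ⟨i, a⟩ ⟨j, b⟩
  exact (congrFun (congrFun (h.noise_symm i j) a) b).symm

theorem IsMAXBET.eq_add (h : IsMAXBET Θ W S) : S = stack Θ * (stack Θ)ᵀ + W := by
  ext ⟨i, a⟩ ⟨j, b⟩
  exact congrFun (congrFun (h.model i j) a) b

theorem IsMAXBET.isSymm (h : IsMAXBET Θ W S) : S.IsSymm := by
  simp [Matrix.IsSymm, h.eq_add, h.isSymm_noise.eq]

theorem IsMAXBET.rowBlock_mul_stack (h : IsMAXBET Θ W S) (i : Fin m) :
    rowBlock (S * stack O) i = Θ i * ((stack Θ)ᵀ * stack O) + rowBlock (W * stack O) i := by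
  rw [h.eq_add, Matrix.add_mul, Matrix.mul_assoc]
  rfl

theorem norm_rowBlock_noise_le (h : ‖stack O - stack Θ‖ ≤ 4 * opNorm W * √(r / m)) (i : Fin m) :
    ‖rowBlock (W * stack O) i‖ ≤ noiseLevel Θ W := by
  have hsplit : rowBlock (W * stack O) i =
      rowBlock (W * stack Θ) i + rowBlock (W * (stack O - stack Θ)) i := by
    rw [Matrix.mul_sub]
    exact (add_sub_cancel _ _).symm
  rw [hsplit]
  refine (norm_add_le _ _).trans (add_le_add ?_ ?_)
  · rw [← frobNorm_eq_norm]
    exact le_ciSup (f := fun i => frobNorm (rowBlock (W * stack Θ) i))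
      (Set.finite_range _).bddAbove i
  · calc ‖rowBlock (W * (stack O - stack Θ)) i‖ ≤ ‖W * (stack O - stack Θ)‖ :=
          norm_rowBlock_le _ _
      _ ≤ opNorm W * ‖stack O - stack Θ‖ := norm_mul_le_opNorm _ _
      _ ≤ opNorm W * (4 * opNorm W * √(r / m)) := by
          gcongr
          exact opNorm_nonneg W
      _ = 4 * opNorm W ^ 2 * √(r / m) := by ring

theorem noiseLevel_nonneg : 0 ≤ noiseLevel Θ W :=
  add_nonneg (Real.iSup_nonneg fun _ => Real.sqrt_nonneg _) (by positivity)

theorem IsMAXBET.mul_norm_sub_le (h : IsMAXBET Θ W S) (hO : IsOTSMSolution S O)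
    (hP : ((stack Θ)ᵀ * stack O).PosSemidef) {c a : ℝ} (i : Fin m)
    (hc : ∀ X : Matrix (Fin r) (Fin (d i)) ℝ,
      c * ‖X‖ ^ 2 ≤ ⟪X, (stack Θ)ᵀ * stack O * X⟫_ℝ)
    (ha : ‖rowBlock (W * stack O) i‖ ≤ a) :
    (c - opNorm W) * ‖Θ i - O i‖ ≤ 2 * a := by
  set E := Θ i - O i with hE
  have hupdate := hO.update_le h.isSymm i (h.semiorth i)
  rw [h.rowBlock_mul_stack, inner_add_right, mul_add,
    two_mul_inner_sub_mul (P := (stack Θ)ᵀ * stack O) (hO.1 i) (h.semiorth i) hP.1, h.eq_add,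
    inner_signal_add_noise_mul, ← hE] at hupdate
  have hsignal := hc Eᵀ
  rw [Matrix.frobenius_norm_transpose] at hsignal
  have hquad := neg_le_of_abs_le (abs_inner_mul_self_le W (singleBlock i E))
  rw [norm_singleBlock] at hquad
  have hnoise : -(‖E‖ * a) ≤ ⟪E, rowBlock (W * stack O) i⟫_ℝ :=
    neg_le_of_abs_le <| (abs_real_inner_le_norm _ _).trans <| by gcongr
  refine mul_le_of_mul_sq_le (norm_nonneg E) (by linarith [(norm_nonneg _).trans ha]) ?_
  linarith [sq_nonneg ‖(stack Θ)ᵀ * singleBlock i E‖]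

theorem IsMAXBET.inner_mul_self_le_of_transpose_mul_eq_zero {q : Type*} [Fintype q]
    (h : IsMAXBET Θ W S) {R : Matrix (Idx d) q ℝ} (hR : (stack O)ᵀ * R = 0) :
    ⟪R, S * R⟫_ℝ ≤ (‖stack O - stack Θ‖ ^ 2 + opNorm W) * ‖R‖ ^ 2 := by
  have hsignal : ‖(stack Θ)ᵀ * R‖ ≤ ‖stack O - stack Θ‖ * ‖R‖ :=
    calc ‖(stack Θ)ᵀ * R‖ = ‖(stack O - stack Θ)ᵀ * R‖ := by
          rw [Matrix.transpose_sub, Matrix.sub_mul, hR, zero_sub, norm_neg]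
      _ ≤ ‖(stack O - stack Θ)ᵀ‖ * ‖R‖ := Matrix.frobenius_norm_mul _ _
      _ = ‖stack O - stack Θ‖ * ‖R‖ := by rw [Matrix.frobenius_norm_transpose]
  rw [h.eq_add, inner_signal_add_noise_mul, add_mul, ← mul_pow]
  gcongr
  exact le_of_abs_le (abs_inner_mul_self_le W R)

theorem IsMAXBET.exists_isOTSMSolution_posSemidef (h : IsMAXBET Θ W S) :
    ∃ O : (i : Fin m) → Matrix (Fin (d i)) (Fin r) ℝ,
      IsOTSMSolution S O ∧ ((stack Θ)ᵀ * stack O).PosSemidef := by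
  obtain ⟨O, hO⟩ := exists_isOTSMSolution S h.semiorth
  obtain ⟨Q, hQ, hpsd⟩ := exists_posSemidef_mul ((stack Θ)ᵀ * stack O)
  rw [Matrix.mul_assoc] at hpsd
  exact ⟨fun i => O i * Q, hO.mul_orthogonal hQ, hpsd⟩

theorem IsMAXBET.norm_stack_sub_le (h : IsMAXBET Θ W S) (hm : m ≠ 0) (hO : IsOTSMSolution S O)
    (hP : ((stack Θ)ᵀ * stack O).PosSemidef) :
    ‖stack O - stack Θ‖ ≤ 4 * opNorm W * √(r / m) := by
  have hoptimal := (isOTSMSolution_iff.mp hO).2 Θ h.semiorth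
  rw [h.eq_add] at hoptimal
  simpa using norm_sub_le_of_objective_le (Nat.cast_pos.mpr (Nat.pos_of_ne_zero hm))
    (gram_stack h.semiorth) (gram_stack hO.1) h.isSymm_noise hP hoptimal

/-- The bound `2A / (m - ‖W‖(4√r + 1) - 1)` on the distance of each block of an aligned solution of
the orthogonal trace-sum problem to the corresponding block of the signal. -/
noncomputable def blockError (Θ : (i : Fin m) → Matrix (Fin (d i)) (Fin r) ℝ)
    (W : Matrix (Idx d) (Idx d) ℝ) : ℝ :=
  2 * noiseLevel Θ W / (m - opNorm W * (4 * √r + 1) - 1)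

theorem ne_zero_of_opNorm_lt (hm : opNorm W * (4 * √(r : ℝ) + 1) + 1 < m) : m ≠ 0 := by
  rintro rfl
  have hw := opNorm_nonneg W
  have hpos : 0 < opNorm W * (4 * √(r : ℝ) + 1) + 1 := by positivity
  exact hpos.not_gt (by simpa using hm)

theorem blockError_nonneg (hm : opNorm W * (4 * √(r : ℝ) + 1) + 1 < m) : 0 ≤ blockError Θ W :=
  div_nonneg (mul_nonneg two_pos.le noiseLevel_nonneg) (by linarith)

theorem IsMAXBET.norm_sub_le_blockError (h : IsMAXBET Θ W S)
    (hm : opNorm W * (4 * √(r : ℝ) + 1) + 1 < m) (hO : IsOTSMSolution S O)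
    (hP : ((stack Θ)ᵀ * stack O).PosSemidef) (i : Fin m) : ‖Θ i - O i‖ ≤ blockError Θ W := by
  have hm₀ := ne_zero_of_opNorm_lt hm
  have hdist := h.norm_stack_sub_le hm₀ hO hP
  have hmdist : √m * ‖stack O - stack Θ‖ ≤ 4 * opNorm W * √r :=
    calc √m * ‖stack O - stack Θ‖ ≤ √m * (4 * opNorm W * √(r / m)) := by gcongr
      _ = 4 * opNorm W * √r := by
          rw [Real.sqrt_div (Nat.cast_nonneg r)]
          field_simp
  have hcoercive (X : Matrix (Fin r) (Fin (d i)) ℝ) :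
      (m - 4 * opNorm W * √r) * ‖X‖ ^ 2 ≤ ⟪X, (stack Θ)ᵀ * stack O * X⟫_ℝ :=
    le_trans (by gcongr) (le_inner_gram_mul (Nat.cast_nonneg m) (gram_stack h.semiorth) X)
  have hclose := h.mul_norm_sub_le hO hP i hcoercive (norm_rowBlock_noise_le hdist i)
  rw [blockError, le_div_iff₀ (by linarith)]
  linarith [norm_nonneg (Θ i - O i)]

theorem IsMAXBET.posSemidef_multiplier_sub_smul_one (h : IsMAXBET Θ W S) (hO : IsCriticalPoint S O)
    {ε a : ℝ} (hdist : ‖stack O - stack Θ‖ ≤ √m * ε) (i : Fin m) (hblock : ‖Θ i - O i‖ ≤ ε)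
    (hnoise : ‖rowBlock (W * stack O) i‖ ≤ a) :
    (multiplier S O i - (m - 2 * m * ε - a) • 1).PosSemidef := by
  have hgramΘ := gram_stack h.semiorth
  have hgramO := gram_stack hO.mem_stiefel
  refine posSemidef_of_inner_mul_self_nonneg
    ((hO.isSymm_multiplier i).sub (by simp [Matrix.IsSymm])) fun X => ?_
  set P := (stack Θ)ᵀ * stack O
  have hmdist : √m * ‖stack O - stack Θ‖ ≤ m * ε :=
    calc √m * ‖stack O - stack Θ‖ ≤ √m * (√m * ε) := by gcongr
      _ = m * ε := by rw [← mul_assoc, Real.mul_self_sqrt (Nat.cast_nonneg m)]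
  have hsignal : (m - m * ε) * ‖X‖ ^ 2 ≤ ⟪X, P * X⟫_ℝ :=
    le_trans (by gcongr) (le_inner_gram_mul (Nat.cast_nonneg m) hgramΘ X)
  have hmisalign : ‖Θ i - O i‖ * ‖P * X‖ * ‖X‖ ≤ m * ε * ‖X‖ ^ 2 :=
    calc ‖Θ i - O i‖ * ‖P * X‖ * ‖X‖ ≤ ε * (m * ‖X‖) * ‖X‖ := by
          gcongr
          · exact (norm_nonneg _).trans hblock
          · exact norm_gram_mul_le (Nat.cast_nonneg m) hgramΘ hgramO X
      _ = m * ε * ‖X‖ ^ 2 := by ring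
  have hperturb : ‖rowBlock (W * stack O) i‖ * ‖X‖ ^ 2 ≤ a * ‖X‖ ^ 2 := by gcongr
  have hlower := le_inner_transpose_mul_signal_add_noise (hO.mem_stiefel i) (Θ := Θ i) P
    (rowBlock (W * stack O) i) X
  rw [← h.rowBlock_mul_stack, ← multiplier] at hlower
  rw [Matrix.sub_mul, Matrix.smul_mul, Matrix.one_mul, inner_sub_right, real_inner_smul_right,
    real_inner_self_eq_norm_sq]
  linarith

theorem mul_sq_add_lt_of_small {x ε A w b : ℝ} (hx : 0 < x) (hε : 0 ≤ ε) (hA : 0 ≤ A) (hw : 0 ≤ w)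
    (hb : 0 ≤ b) (h : 4 * x * ε + 2 * A + b + 2 * w < x) :
    x * ε ^ 2 + w < x - 2 * x * ε - A := by
  have hquarter : ε ≤ 1 / 4 := le_of_mul_le_mul_left (by linarith) hx
  have hsq : x * ε ^ 2 ≤ x * (1 / 4) := by
    gcongr
    nlinarith [hquarter]
  linarith

theorem IsMAXBET.exists_isOTSMSolution_isSDPSolution_iff (h : IsMAXBET Θ W S)
    (hm : opNorm W * (4 * √(r : ℝ) + 1) + 1 < m)
    (hsmall : 4 * m * blockError Θ W + 2 * noiseLevel Θ W + 8 * opNorm W * √(r / m) +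
      2 * opNorm W < m) :
    ∃ O : (i : Fin m) → Matrix (Fin (d i)) (Fin r) ℝ, IsOTSMSolution S O ∧
      ∀ U, IsSDPSolution r S U ↔ U = stack O * (stack O)ᵀ := by
  have hw := opNorm_nonneg W
  have hε := blockError_nonneg hm (Θ := Θ)
  have hm₀ := ne_zero_of_opNorm_lt hm
  have hm_pos : (0 : ℝ) < m := by positivity
  obtain ⟨O, hO, hP⟩ := h.exists_isOTSMSolution_posSemidef
  have hcritical := hO.isCriticalPoint h.isSymm
  have hdist := h.norm_stack_sub_le hm₀ hO hP
  have hblock := h.norm_sub_le_blockError hm hO hP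
  have hdist' : ‖stack O - stack Θ‖ ≤ √m * blockError Θ W := by
    rw [norm_sub_rev]
    exact norm_le_sqrt_mul_of_rowBlock_le hε hblock
  refine ⟨O, hO, fun U => hcritical.isSDPSolution_iff hm₀ h.isSymm
    (mul_sq_add_lt_of_small hm_pos hε noiseLevel_nonneg hw (by positivity) hsmall)
    (fun i => h.posSemidef_multiplier_sub_smul_one hcritical hdist' i (hblock i)
      (norm_rowBlock_noise_le hdist i)) fun q _ R hR => ?_⟩
  refine (h.inner_mul_self_le_of_transpose_mul_eq_zero hR).trans ?_
  gcongr
  calc ‖stack O - stack Θ‖ ^ 2 ≤ (√m * blockError Θ W) ^ 2 := by gcongr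
    _ = m * blockError Θ W ^ 2 := by rw [mul_pow, Real.sq_sqrt hm_pos.le]

end Tightness

end OTSM

theorem theorem3p1 (m r : ℕ) (d : Fin m → ℕ)
    (Θ : (i : Fin m) → Matrix (Fin (d i)) (Fin r) ℝ)
    (W S : Matrix (OTSM.Idx d) (OTSM.Idx d) ℝ)
    (hmodel : OTSM.IsMAXBET Θ W S)
    (hm : OTSM.opNorm W * (4 * √(r : ℝ) + 1) + 1 < (m : ℝ))
    (hsmall :
      4 * (m : ℝ) * (2 * OTSM.noiseLevel Θ W /
            ((m : ℝ) - OTSM.opNorm W * (4 * √(r : ℝ) + 1) - 1)) +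
          2 * OTSM.noiseLevel Θ W +
          8 * OTSM.opNorm W * √((r : ℝ) / (m : ℝ)) + 2 * OTSM.opNorm W < (m : ℝ)) :
    (∃ U : Matrix (OTSM.Idx d) (OTSM.Idx d) ℝ, OTSM.IsSDPSolution r S U) ∧
    ∀ U : Matrix (OTSM.Idx d) (OTSM.Idx d) ℝ, OTSM.IsSDPSolution r S U →
      OTSM.IsRankSolution r S U ∧
        ∃ O : (i : Fin m) → Matrix (Fin (d i)) (Fin r) ℝ,
          OTSM.IsOTSMSolution S O ∧ U = OTSM.stack O * (OTSM.stack O).transpose := by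
  obtain ⟨O, hO, hiff⟩ := hmodel.exists_isOTSMSolution_isSDPSolution_iff hm hsmall
  refine ⟨⟨_, (hiff _).mpr rfl⟩, fun U hU => ?_⟩
  obtain rfl := (hiff U).mp hU
  have hrank := OTSM.rank_stack_mul_transpose (OTSM.ne_zero_of_opNorm_lt hm) hO.1
  exact ⟨⟨⟨hU.1, hrank⟩, fun X hX => hU.2 hX.1⟩, O, hO, rfl⟩
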